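/- Consider a stochastic $K$-armed bandit: for each arm $a\in[K]$ the losses $\ell_{1,a},\ell_{2,a},\dots$ are i.i.d. Bernoulli variables with mean $\mu_a\in[0,1]$ and variance $\sigma_a^2=\mu_a(1-\mu_a)$. Let $a_\star\in\arg\min_a\mu_a$, $\mu_\star=\mu_{a_\star}$ and $\Delta_a=\mu_a-\mu_\star$. At each time $t\ge 1$ an arm $a_t$ is chosen; with $n_t(a)=|\{s\le t: a_s=a\}|$, the loss then observed is $\ell_{n_t(a_t),a_t}$. The pseudo-regret is $R_t=\sum_{s=1}^t(\mu_{a_s}-\mu_\star)$. For integers $l\ge1$, $n\ge0$, and $1\le j\le l$ let $\tau_{n,j}^{l}=\{n'\in\{1,\dots,n\}: n'=j+il \text{ for some integer } i\ge0\}$ and $$\hat\mu^{\,l}_{n,a}=\min_{1\le j\le l}\ \frac{\sum_{n'\in\tau^{l}_{n,j}}\ell_{n',a}}{|\tau^{l}_{n,j}|+2}$$ (an empty sum is $0$). The Batch Ensemble algorithm with $l_t$ batches at time $t$ plays, at each time $t\ge1$, an arm $a_t\in\arg\min_a\hat\mu^{\,l_t}_{n_{t-1}(a),a}$, with ties broken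 arbitrarily. Suppose the algorithm is run with $l_t=8\log t$ batches, rounded to a positive integer (that is, $l_t\ge1$ is any integer with $|l_t-8\log t|\le1$). Then for every $t\ge1$ $$\mathbb E[R_t]\le\sum_{a:\Delta_a>0}9\Big[\frac{8\sigma_a^2}{\Delta_a}+\frac43\Big]\log^2(72t)\le\sum_{a:\Delta_a>0}9\Big[\frac{8\mu_\star}{\Delta_a}+\frac{28}{3}\Big]\log^2(72t)$$ and $$\mathbb E[R_t]\le17\sqrt{t\cdot\min\Big\{\mu_\star K,\ \sum_{a\ne a_\star}\sigma_a^2\Big\}}\,\log(72t)+84K\log^2(72t).$$ -/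

import Mathlib

open MeasureTheory ProbabilityTheory

noncomputable section

namespace BatchEnsemble

/-- A stochastic Bernoulli bandit with `K` arms on the probability space `(Ω, P)`: for every arm
`a`, the losses `ℓ a 1, ℓ a 2, …` are independent Bernoulli variables with parameter `μ a`.
(The value `ℓ a 0` is never used; no assumption is made on the joint law of different arms.) -/
structure IsBernoulliBandit {Ω : Type*} [MeasurableSpace Ω] (P : Measure Ω) {K : ℕ}
    (μ : Fin K → unitInterval) (ℓ : Fin K → ℕ → Ω → ℝ) : Prop where
  measurable_loss : ∀ a n, 1 ≤ n → Measurable (ℓ a n)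
  law_loss : ∀ a n, 1 ≤ n → HasLaw (ℓ a n) (bernoulliMeasure (1 : ℝ) 0 (μ a)) P
  indep_loss : ∀ a, iIndepFun (fun n : ℕ => ℓ a (n + 1)) P

open Classical in
/-- The round-robin batch number `j` (where `1 ≤ j ≤ l`) of the sample indices `1, …, n`:
the indices `n' ≤ n` of the form `j + i * l`. -/
def batch (l n j : ℕ) : Finset ℕ :=
  {n' ∈ Finset.Icc 1 n | ∃ i : ℕ, n' = j + i * l}

/-- The estimate of batch `j` from the first `n` terms of the loss sequence `x`
(the sum of the batch, divided by its size plus two). -/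
def batchEstimate (l n j : ℕ) (x : ℕ → ℝ) : ℝ :=
  (∑ n' ∈ batch l n j, x n') / ((batch l n j).card + 2 : ℝ)

/-- The batch ensemble estimate with `l ≥ 1` batches: the minimum of the batch estimates over the
batches `1, …, l`. -/
def estimate (l n : ℕ) (x : ℕ → ℝ) : ℝ :=
  ⨅ j : Fin l, batchEstimate l n (j + 1) x

/-- The number of times that the arm `b` is played in the time steps `1, …, t`. -/
def pullCount {K : ℕ} (A : ℕ → Fin K) (b : Fin K) (t : ℕ) : ℕ :=
  ((Finset.Icc 1 t).filter fun s => A s = b).card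

/-- The sequence of arms `A 1, A 2, …` is an execution of the batch ensemble algorithm with `l t`
batches at time `t` on the loss table `x`: in each step `t ≥ 1` an arm is played that minimizes the
batch ensemble estimate built from the losses of that arm observed before time `t`.
Ties may be broken in any way. -/
def IsExecution {K : ℕ} (l : ℕ → ℕ) (x : Fin K → ℕ → ℝ) (A : ℕ → Fin K) : Prop :=
  ∀ t : ℕ, 1 ≤ t → ∀ b : Fin K,
    estimate (l t) (pullCount A (A t) (t - 1)) (x (A t)) ≤
      estimate (l t) (pullCount A b (t - 1)) (x b)

/-- The pseudo-regret, up to time `t`, of the sequence of arms `A` with respect to the arm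
`aStar`. -/
def regret {K : ℕ} (μ : Fin K → unitInterval) (aStar : Fin K) (A : ℕ → Fin K) (t : ℕ) : ℝ :=
  ∑ s ∈ Finset.Icc 1 t, ((μ (A s) : ℝ) - μ aStar)

/-- The optimality gap of the arm `a` with respect to the arm `aStar`. -/
def gap {K : ℕ} (μ : Fin K → unitInterval) (aStar a : Fin K) : ℝ :=
  (μ a : ℝ) - μ aStar

open Classical in
/-- The sub-optimal arms, i.e. those with a positive gap. -/
def subOptimal {K : ℕ} (μ : Fin K → unitInterval) (aStar : Fin K) : Finset (Fin K) :=
  {a | 0 < gap μ aStar a}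

end BatchEnsemble

end

/-!
The proof rests on two properties of the estimate of an arm, which is the smallest of `l` batch
averages.

*Optimism.* A binomial variable with parameters `m` and `p` is at most `(m + 2) * p` with
probability at least `1 / e` (`exp_neg_one_le_binomialCDF_mean`, `one_fourth_le_binomialCDF`). As a
function of `p`, the binomial distribution function at `k` is the survival function `F` of a Beta
variable `B` with mean `(k + 1) / (m + 1)`. It is log-concave, and `F B` is uniform on `[0, 1]`, so
that Jensen's inequality gives `log (F (E[B])) ≥ E[log (F B)] = -1`. The batches are disjoint,
hence independent, and all of them exceed the mean of the arm with probability at most `(3 / 4) ^ l`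
(`measureReal_forall_lt_batchEstimate_le`). With `l ≈ 8 * log s` batches this is `O(s⁻²)`, and a
union bound over the number of plays of the best arm leaves `O(1 / s)` at time `s`, which sums to
`O(log t)`.

*Accuracy.* By Bernstein's inequality a batch of a sub-optimal arm with gap `Δ` and variance `σ²`
falls below the best mean with probability at most `1 / (72 * t)` once it has
`(8 * σ² / Δ² + 4 / (3 * Δ)) * log (72 * t)` elements (`measureReal_batchEstimate_le`). The number
of batches varies with the time, so the union bound runs over all numbers of plays, all
`r ≤ 8 * log t + 1` and all batches out of `r`; it costs `O(log² t)` plays.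

If the best arm is estimated optimistically, a sub-optimal arm is played only if one of its batches
lies below the best mean. Counting plays (`pullCount_le_sum`) therefore bounds the expected
contribution of each sub-optimal arm to the regret (`gap_mul_integral_pullCount_le`), and the sum of
these is the gap-dependent bound. The gap-free bound combines the contributions `Δ * E[n]`
with the trivial constraint that the expected numbers of plays `E[n]` sum to `t`, by means of the
Cauchy–Schwarz inequality (`sum_mul_le_sqrt`).
-/

namespace BatchEnsemble

/-! ### Binomial distribution functions and the mean of the Beta law -/

/-- The distribution function at `k` of the binomial law with parameters `m` and `p`, as a
polynomial function of `p`. -/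
noncomputable def binomialCDF (m k : ℕ) (p : ℝ) : ℝ :=
  ∑ i ∈ Finset.range (k + 1), (bernsteinPolynomial ℝ m i).eval p

theorem eval_bernsteinPolynomial (m i : ℕ) (p : ℝ) :
    (bernsteinPolynomial ℝ m i).eval p = m.choose i * p ^ i * (1 - p) ^ (m - i) := by
  simp [bernsteinPolynomial]

theorem eval_bernsteinPolynomial_nonneg (m i : ℕ) {p : ℝ} (h0 : 0 ≤ p) (h1 : p ≤ 1) :
    0 ≤ (bernsteinPolynomial ℝ m i).eval p := by
  rw [eval_bernsteinPolynomial]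
  have : 0 ≤ 1 - p := by linarith
  positivity

theorem hasDerivAt_binomialCDF (n k : ℕ) (x : ℝ) :
    HasDerivAt (binomialCDF (n + 1) k)
      (-((n + 1 : ℝ) * (bernsteinPolynomial ℝ n k).eval x)) x := by
  have h : ∀ i, HasDerivAt (fun p : ℝ => (bernsteinPolynomial ℝ (n + 1) i).eval p)
      ((bernsteinPolynomial ℝ (n + 1) i).derivative.eval x) x := fun i => Polynomial.hasDerivAt _ x
  refine (HasDerivAt.fun_sum (u := Finset.range (k + 1)) fun i _ => h i).congr_deriv ?_
  clear h
  symm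
  induction k with
  | zero =>
    simp [bernsteinPolynomial.derivative_zero]
    ring
  | succ k ih =>
    rw [Finset.sum_range_succ, ← ih, bernsteinPolynomial.derivative_succ]
    simp
    ring

theorem binomialCDF_zero (m k : ℕ) : binomialCDF m k 0 = 1 := by
  simp [binomialCDF, bernsteinPolynomial.eval_at_0]

theorem binomialCDF_one {m k : ℕ} (h : k < m) : binomialCDF m k 1 = 0 := by
  refine Finset.sum_eq_zero fun i hi => ?_
  rw [bernsteinPolynomial.eval_at_1, if_neg]
  have := Finset.mem_range.1 hi
  omega

theorem binomialCDF_eq_one {m k : ℕ} (h : m ≤ k) (p : ℝ) : binomialCDF m k p = 1 := by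
  have h1 : binomialCDF m m p = 1 := by
    rw [binomialCDF, ← Polynomial.eval_finsetSum, bernsteinPolynomial.sum]; simp
  rw [← h1]
  symm
  refine Finset.sum_subset (Finset.range_mono (by omega)) fun i _ hi => ?_
  rw [bernsteinPolynomial.eq_zero_of_lt]
  · simp
  · simpa using hi

theorem binomialCDF_pos (m k : ℕ) {p : ℝ} (h0 : 0 ≤ p) (h1 : p < 1) :
    0 < binomialCDF m k p := by
  refine Finset.sum_pos' (fun i _ => eval_bernsteinPolynomial_nonneg m i h0 h1.le)
    ⟨0, by simp, ?_⟩
  rw [eval_bernsteinPolynomial]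
  have : 0 < 1 - p := by linarith
  simp only [Nat.choose_zero_right, Nat.cast_one, pow_zero, mul_one, one_mul]
  positivity

theorem antitoneOn_binomialCDF (n k : ℕ) :
    AntitoneOn (binomialCDF (n + 1) k) (Set.Icc 0 1) := by
  refine antitoneOn_of_hasDerivWithinAt_nonpos (convex_Icc 0 1)
    (fun x _ => (hasDerivAt_binomialCDF n k x).continuousAt.continuousWithinAt)
    (fun x _ => (hasDerivAt_binomialCDF n k x).hasDerivWithinAt) fun x hx => ?_
  rw [interior_Icc] at hx
  have := eval_bernsteinPolynomial_nonneg n k hx.1.le hx.2.le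
  have : 0 ≤ (n + 1 : ℝ) * (bernsteinPolynomial ℝ n k).eval x := by positivity
  linarith

/-- The hazard rate of the Beta law with parameters `k + 1` and `n + 1 - k` is increasing. It is
`(n + 1) * b / F`, with `b` a Bernstein polynomial and `F` a binomial distribution function; the
inequality holds for each term of the sum that defines `F`. -/
theorem bernstein_mul_binomialCDF_le {n k : ℕ} (hk : k ≤ n) {x y : ℝ} (hx : 0 ≤ x) (hxy : x ≤ y)
    (hy : y ≤ 1) :
    (bernsteinPolynomial ℝ n k).eval x * binomialCDF (n + 1) k y ≤
      (bernsteinPolynomial ℝ n k).eval y * binomialCDF (n + 1) k x := by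
  rw [binomialCDF, binomialCDF, Finset.mul_sum, Finset.mul_sum]
  refine Finset.sum_le_sum fun i hi => ?_
  have hik : i ≤ k := by have := Finset.mem_range.1 hi; omega
  obtain ⟨d, rfl⟩ := Nat.exists_eq_add_of_le hik
  obtain ⟨e, rfl⟩ := Nat.exists_eq_add_of_le hk
  simp only [eval_bernsteinPolynomial]
  rw [show i + d + e - (i + d) = e by omega, show i + d + e + 1 - i = e + (d + 1) by omega]
  have hx' : 0 ≤ 1 - x := by linarith
  have hy' : 0 ≤ 1 - y := by linarith
  have hy0 : 0 ≤ y := by linarith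
  have key : x ^ d * (1 - y) ^ (d + 1) ≤ y ^ d * (1 - x) ^ (d + 1) := by gcongr
  have := mul_le_mul_of_nonneg_left key (show
    0 ≤ ((i + d + e).choose (i + d) : ℝ) * ((i + d + e + 1).choose i) * (x * y) ^ i
      * ((1 - x) * (1 - y)) ^ e by positivity)
  calc _ = ((i + d + e).choose (i + d) : ℝ) * ((i + d + e + 1).choose i) * (x * y) ^ i
      * ((1 - x) * (1 - y)) ^ e * (x ^ d * (1 - y) ^ (d + 1)) := by
        rw [mul_pow, mul_pow, pow_add, pow_add]; ring
    _ ≤ _ := this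
    _ = _ := by rw [mul_pow, mul_pow, pow_add, pow_add (1 - x)]; ring

/-- The function `log F`, with `F` a binomial distribution function, is concave in the parameter
`p`: it lies below its tangent at `c`. -/
theorem log_binomialCDF_le_tangent {n k : ℕ} (hk : k ≤ n) {c x : ℝ} (hc : c ∈ Set.Ioo (0 : ℝ) 1)
    (hx : x ∈ Set.Ioo (0 : ℝ) 1) :
    Real.log (binomialCDF (n + 1) k x) ≤ Real.log (binomialCDF (n + 1) k c)
      - ((n + 1 : ℝ) * (bernsteinPolynomial ℝ n k).eval c / binomialCDF (n + 1) k c)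
        * (x - c) := by
  set F := binomialCDF (n + 1) k with hF
  set b : ℝ → ℝ := fun y => (bernsteinPolynomial ℝ n k).eval y with hb
  set ψ : ℝ → ℝ := fun y => (n + 1 : ℝ) * b y / F y with hψ
  have Fpos : ∀ y ∈ Set.Ioo (0 : ℝ) 1, 0 < F y := fun y hy => binomialCDF_pos _ _ hy.1.le hy.2
  have mono : ∀ y ∈ Set.Ioo (0 : ℝ) 1, ∀ z ∈ Set.Ioo (0 : ℝ) 1, y ≤ z → ψ y ≤ ψ z := by
    intro y hy z hz hyz
    have h := bernstein_mul_binomialCDF_le hk hy.1.le hyz hz.2.le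
    simp only [hψ]
    rw [div_le_div_iff₀ (Fpos y hy) (Fpos z hz), mul_assoc, mul_assoc]
    exact mul_le_mul_of_nonneg_left h (by positivity)
  have hD : ∀ y ∈ Set.Ioo (0 : ℝ) 1,
      HasDerivAt (fun y => Real.log (F y) + ψ c * (y - c)) (-ψ y + ψ c) y := by
    intro y hy
    have h1 := (hasDerivAt_binomialCDF n k y).log (Fpos y hy).ne'
    have h2 := ((hasDerivAt_id y).sub_const c).const_mul (ψ c)
    refine (h1.add h2).congr_deriv ?_
    simp only [hψ, hb]
    ring
  have key : Real.log (F x) + ψ c * (x - c) ≤ Real.log (F c) + ψ c * (c - c) := by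
    rcases le_total x c with h | h
    · have hsub : Set.Icc x c ⊆ Set.Ioo 0 1 := fun y hy =>
        ⟨hx.1.trans_le hy.1, hy.2.trans_lt hc.2⟩
      refine monotoneOn_of_hasDerivWithinAt_nonneg (convex_Icc x c)
        (fun y hy => (hD y (hsub hy)).continuousAt.continuousWithinAt)
        (fun y hy => (hD y (hsub (interior_subset hy))).hasDerivWithinAt) (fun y hy => ?_)
        (Set.left_mem_Icc.2 h) (Set.right_mem_Icc.2 h) h
      have := mono y (hsub (interior_subset hy)) c hc (interior_subset hy).2
      linarith
    · have hsub : Set.Icc c x ⊆ Set.Ioo 0 1 := fun y hy =>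
        ⟨hc.1.trans_le hy.1, hy.2.trans_lt hx.2⟩
      refine antitoneOn_of_hasDerivWithinAt_nonpos (convex_Icc c x)
        (fun y hy => (hD y (hsub hy)).continuousAt.continuousWithinAt)
        (fun y hy => (hD y (hsub (interior_subset hy))).hasDerivWithinAt) (fun y hy => ?_)
        (Set.left_mem_Icc.2 h) (Set.right_mem_Icc.2 h) h
      have := mono c hc y (hsub (interior_subset hy)) (interior_subset hy).1
      linarith
  simp only [sub_self, mul_zero, add_zero] at key
  simp only [hψ] at key
  linarith

/-- The value of a binomial distribution function `F` with `n + 1` trials at the mean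
`c = (k + 1) / (n + 2)` of the corresponding Beta law `B` is at least `1 / e`. As `F B` is uniform
on `[0, 1]` and `log F` is concave, Jensen's inequality gives `log (F c) ≥ E[log (F B)] = -1`.
The proof integrates the tangent inequality against the density `-F'` by means of an explicit
antiderivative. -/
theorem exp_neg_one_le_binomialCDF_mean {n k : ℕ} (hk : k ≤ n) :
    Real.exp (-1) ≤ binomialCDF (n + 1) k ((k + 1) / (n + 2)) := by
  set c : ℝ := (k + 1) / (n + 2) with hc_def
  have hkn : (k : ℝ) ≤ n := by exact_mod_cast hk
  have hc : c ∈ Set.Ioo (0 : ℝ) 1 := by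
    constructor
    · positivity
    · rw [hc_def, div_lt_one (by positivity)]; linarith
  set F := binomialCDF (n + 1) k with hF
  set b : ℝ → ℝ := fun y => (bernsteinPolynomial ℝ n k).eval y with hb
  set s : ℝ := (n + 1 : ℝ) * b c / F c with hs
  have hFd : ∀ x, HasDerivAt F (-((n + 1 : ℝ) * b x)) x := fun x => hasDerivAt_binomialCDF n k x
  -- an antiderivative of `F`
  set G : ℝ → ℝ := fun x => -(∑ i ∈ Finset.range (k + 1), binomialCDF (n + 2) i x) / (n + 2)
    with hG
  have hGd : ∀ x, HasDerivAt G (F x) x := by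
    intro x
    have h := HasDerivAt.fun_sum (u := Finset.range (k + 1))
      (fun i _ => hasDerivAt_binomialCDF (n + 1) i x)
    refine (h.neg.div_const (n + 2 : ℝ)).congr_deriv ?_
    rw [hF, binomialCDF, ← Finset.sum_neg_distrib, Finset.sum_div]
    refine Finset.sum_congr rfl fun i _ => ?_
    push_cast
    have : (n + 2 : ℝ) ≠ 0 := by positivity
    field_simp
    ring
  have hG0 : G 0 = -c := by
    simp only [hG, binomialCDF_zero, hc_def]
    simp
    ring
  have hG1 : G 1 = 0 := by
    simp only [hG]
    rw [Finset.sum_eq_zero]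
    · simp
    · intro i hi
      have := Finset.mem_range.1 hi
      exact binomialCDF_one (by omega)
  set Φ : ℝ → ℝ := fun x => F x * Real.log (F x) - F x - Real.log (F c) * F x
    + s * ((x - c) * F x - G x) with hΦ
  have hF0 : F 0 = 1 := binomialCDF_zero _ _
  have hF1 : F 1 = 0 := binomialCDF_one (by omega)
  have hFc : Continuous F := continuous_iff_continuousAt.2 fun x => (hFd x).continuousAt
  have hGc : Continuous G := continuous_iff_continuousAt.2 fun x => (hGd x).continuousAt
  have hΦc : Continuous Φ := by
    have : Continuous fun x => F x * Real.log (F x) := Real.continuous_mul_log.comp hFc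
    fun_prop
  have hΦd : ∀ x ∈ Set.Ioo (0 : ℝ) 1, HasDerivAt Φ
      (-((n + 1 : ℝ) * b x) * (Real.log (F x) - Real.log (F c) + s * (x - c))) x := by
    intro x hx
    have hpos : F x ≠ 0 := (binomialCDF_pos _ _ hx.1.le hx.2).ne'
    have h1 := (hFd x).mul ((hFd x).log hpos)
    have h2 := ((((hasDerivAt_id x).sub_const c).mul (hFd x)).sub (hGd x)).const_mul s
    refine (((h1.sub (hFd x)).sub ((hFd x).const_mul (Real.log (F c)))).add h2).congr_deriv ?_
    simp only [id]
    field_simp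
    ring
  have hmono : MonotoneOn Φ (Set.Icc 0 1) := by
    refine monotoneOn_of_hasDerivWithinAt_nonneg (convex_Icc 0 1) hΦc.continuousOn
      (fun y hy => (hΦd y (by rwa [interior_Icc] at hy)).hasDerivWithinAt) fun y hy => ?_
    rw [interior_Icc] at hy
    have h1 := log_binomialCDF_le_tangent hk hc hy
    have h2 := eval_bernsteinPolynomial_nonneg n k hy.1.le hy.2.le
    refine mul_nonneg_of_nonpos_of_nonpos ?_ ?_
    · have : 0 ≤ (n + 1 : ℝ) * b y := by positivity
      linarith
    · simp only [hs, hb, hF]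
      linarith
  have h01 := hmono (Set.left_mem_Icc.2 zero_le_one) (Set.right_mem_Icc.2 zero_le_one) zero_le_one
  simp only [hΦ, hF0, hF1, hG0, hG1, Real.log_one] at h01
  rw [← Real.le_log_iff_exp_le (binomialCDF_pos _ _ hc.1.le hc.2)]
  linarith

/-- A binomial variable with `m` trials is at most `(m + 2) * p` with probability at least
`1 / 4`. -/
theorem one_fourth_le_binomialCDF (m : ℕ) {p : ℝ} (h0 : 0 ≤ p) (h1 : p ≤ 1) :
    1 / 4 ≤ binomialCDF m ⌊(m + 2) * p⌋₊ p := by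
  set k := ⌊(m + 2) * p⌋₊ with hk
  rcases le_or_gt m k with h | h
  · rw [binomialCDF_eq_one h]; norm_num
  obtain ⟨n, rfl⟩ : ∃ n, m = n + 1 := ⟨m - 1, by omega⟩
  have hkn : k ≤ n := by omega
  have hkn' : (k : ℝ) ≤ n := by exact_mod_cast hkn
  have hlt : ((n + 1 : ℕ) + 2) * p < k + 1 := Nat.lt_floor_add_one _
  push_cast at hlt
  have hp : p ≤ (k + 1) / (n + 2) := by
    rw [le_div_iff₀ (by positivity)]; nlinarith
  have hc : ((k : ℝ) + 1) / (n + 2) ≤ 1 := by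
    rw [div_le_one (by positivity)]; linarith
  calc (1 / 4 : ℝ) ≤ Real.exp (-1) := by
        rw [Real.exp_neg, one_div]
        exact inv_anti₀ (Real.exp_pos 1) (by linarith [Real.exp_one_lt_d9])
    _ ≤ _ := exp_neg_one_le_binomialCDF_mean hkn
    _ ≤ _ := antitoneOn_binomialCDF n k ⟨h0, h1⟩ ⟨by positivity, hc⟩ hp

/-! ### Recursion for the binomial distribution function -/

theorem binomialCDF_succ_zero (m : ℕ) (p : ℝ) :
    binomialCDF (m + 1) 0 p = (1 - p) * binomialCDF m 0 p := by
  simp [binomialCDF, eval_bernsteinPolynomial, pow_succ']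

theorem eval_bernsteinPolynomial_succ_succ (m i : ℕ) (p : ℝ) :
    (bernsteinPolynomial ℝ (m + 1) (i + 1)).eval p =
      p * (bernsteinPolynomial ℝ m i).eval p
        + (1 - p) * (bernsteinPolynomial ℝ m (i + 1)).eval p := by
  simp only [eval_bernsteinPolynomial, Nat.choose_succ_succ, Nat.add_sub_add_right]
  rcases lt_or_ge i m with h | h
  · rw [show m - i = m - (i + 1) + 1 by omega]
    push_cast
    ring
  · rw [Nat.choose_eq_zero_of_lt (show m < i + 1 by omega)]
    push_cast
    ring

theorem binomialCDF_succ_succ (m k : ℕ) (p : ℝ) :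
    binomialCDF (m + 1) (k + 1) p = p * binomialCDF m k p + (1 - p) * binomialCDF m (k + 1) p := by
  simp only [binomialCDF]
  rw [Finset.sum_range_succ', Finset.sum_range_succ' _ (k + 1)]
  simp only [eval_bernsteinPolynomial_succ_succ, Finset.sum_add_distrib, mul_add, Finset.mul_sum]
  simp [eval_bernsteinPolynomial, pow_succ', add_assoc]

/-! ### Bernstein's bound for the exponential moments of a Bernoulli variable -/

theorem two_sub_mul_exp_le {y : ℝ} (hy : 0 ≤ y) : (2 - y) * Real.exp y ≤ 2 + y := by
  have hd : ∀ x : ℝ, HasDerivAt (fun x : ℝ => 2 + x - (2 - x) * Real.exp x)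
      (1 - (1 - x) * Real.exp x) x := by
    intro x
    refine (((hasDerivAt_id x).const_add 2).sub
      (((hasDerivAt_id x).const_sub 2).mul (Real.hasDerivAt_exp x))).congr_deriv ?_
    simp only [id]
    ring
  have hmono : Monotone (fun x : ℝ => 2 + x - (2 - x) * Real.exp x) := by
    refine monotone_of_hasDerivAt_nonneg hd fun x => ?_
    have h1 : (1 - x) * Real.exp x ≤ Real.exp (-x) * Real.exp x := by
      gcongr
      linarith [Real.add_one_le_exp (-x)]
    rw [← Real.exp_add, neg_add_cancel, Real.exp_zero] at h1
    simpa using h1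
  have := hmono hy
  simp at this
  linarith

/-- The bound `y ^ k / k ! ≤ y ^ 2 / 2 * (y / 3) ^ (k - 2)` for each term of the exponential series
with `k ≥ 2`, summed; it is proved here by differentiation. -/
theorem exp_le_of_nonneg_of_lt_three {y : ℝ} (hy : 0 ≤ y) (hy3 : y < 3) :
    Real.exp y ≤ 1 + y + y ^ 2 / (2 * (1 - y / 3)) := by
  have hd : ∀ x : ℝ, HasDerivAt
      (fun x : ℝ => x ^ 2 / 2 - (1 - x / 3) * (Real.exp x - 1 - x))
      ((2 + x - (2 - x) * Real.exp x) / 3) x := by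
    intro x
    refine (((hasDerivAt_pow 2 x).div_const 2).sub
      ((((hasDerivAt_id x).div_const 3).const_sub 1).mul
        (((Real.hasDerivAt_exp x).sub_const 1).sub (hasDerivAt_id x)))).congr_deriv ?_
    simp only [id, Pi.sub_apply]
    push_cast
    ring
  have hmono : MonotoneOn (fun x : ℝ => x ^ 2 / 2 - (1 - x / 3) * (Real.exp x - 1 - x))
      (Set.Ici 0) := by
    refine monotoneOn_of_hasDerivWithinAt_nonneg (convex_Ici 0)
      (fun x _ => (hd x).continuousAt.continuousWithinAt)
      (fun x _ => (hd x).hasDerivWithinAt) fun x hx => ?_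
    rw [interior_Ici] at hx
    have := two_sub_mul_exp_le hx.le
    linarith
  have h := hmono Set.self_mem_Ici hy hy
  simp at h
  have h3 : 0 < 1 - y / 3 := by linarith
  rw [← sub_le_iff_le_add', le_div_iff₀ (by positivity)]
  nlinarith

theorem exp_le_of_nonpos {y : ℝ} (hy : y ≤ 0) : Real.exp y ≤ 1 + y + y ^ 2 / 2 := by
  have h := Real.quadratic_le_exp_of_nonneg (neg_nonneg.2 hy)
  have h1 : Real.exp y * Real.exp (-y) = 1 := by rw [← Real.exp_add]; simp
  nlinarith [Real.exp_pos y, sq_nonneg (y ^ 2), sq_nonneg (1 + y)]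

theorem bernoulli_mgf_neg_le {p s : ℝ} (h0 : 0 ≤ p) (h1 : p ≤ 1) (hs : 0 ≤ s) (hs3 : s < 3) :
    1 - p + p * Real.exp (-s) ≤
      Real.exp (-s * p + s ^ 2 * (p * (1 - p)) / (2 * (1 - s / 3))) := by
  have hq : 0 ≤ 1 - p := by linarith
  have hpos : 0 < 2 * (1 - s / 3) := by linarith
  have hsp : s * p ≤ s := by nlinarith
  have e1 : Real.exp (s * p) ≤ 1 + s * p + (s * p) ^ 2 / (2 * (1 - s / 3)) := by
    refine (exp_le_of_nonneg_of_lt_three (by positivity) (by linarith)).trans ?_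
    gcongr
  have e2 : Real.exp (-(s * (1 - p))) ≤
      1 - s * (1 - p) + (s * (1 - p)) ^ 2 / (2 * (1 - s / 3)) := by
    refine (exp_le_of_nonpos (by nlinarith)).trans ?_
    rw [neg_sq, ← sub_eq_add_neg]
    gcongr
    linarith
  have e3 := Real.add_one_le_exp (s ^ 2 * (p * (1 - p)) / (2 * (1 - s / 3)))
  rw [Real.exp_add]
  calc 1 - p + p * Real.exp (-s)
      = Real.exp (-s * p) * ((1 - p) * Real.exp (s * p) + p * Real.exp (-(s * (1 - p)))) := by
        rw [mul_add, mul_left_comm, mul_left_comm _ p, ← Real.exp_add, ← Real.exp_add]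
        ring_nf
        simp only [Real.exp_zero]
        ring
    _ ≤ Real.exp (-s * p) * ((1 - p) * (1 + s * p + (s * p) ^ 2 / (2 * (1 - s / 3)))
          + p * (1 - s * (1 - p) + (s * (1 - p)) ^ 2 / (2 * (1 - s / 3)))) := by gcongr
    _ = Real.exp (-s * p) * (s ^ 2 * (p * (1 - p)) / (2 * (1 - s / 3)) + 1) := by ring
    _ ≤ _ := by gcongr

/-- The choice of the parameter in Bernstein's inequality, for a deviation of half the gap `d`. If
the variance vanishes, then `p = 1` and any large parameter will do. -/
theorem exists_bernoulli_mgf_neg_le {p d : ℝ} (hd : 0 < d) (hdp : d ≤ p) (h1 : p ≤ 1) :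
    ∃ s : ℝ, 0 ≤ s ∧ 1 - p + p * Real.exp (-s) ≤
      Real.exp (-(s * (p - d / 2)) - d ^ 2 / (8 * (p * (1 - p)) + 4 / 3 * d)) := by
  rcases h1.eq_or_lt with rfl | h1
  · refine ⟨3, by norm_num, ?_⟩
    simp only [sub_self, mul_zero, zero_add, one_mul]
    rw [Real.exp_le_exp]
    have : d ^ 2 / (4 / 3 * d) = 3 / 4 * d := by field_simp
    rw [this]
    linarith
  · have hp : 0 < p := hd.trans_le hdp
    have hv : 0 < p * (1 - p) := mul_pos hp (by linarith)
    set v := p * (1 - p) with hv_def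
    -- the usual choice `x / (v + x / 3)` for the deviation `x = d / 2`
    refine ⟨3 * d / (6 * v + d), by positivity, ?_⟩
    refine (bernoulli_mgf_neg_le hp.le h1.le (by positivity) ?_).trans ?_
    · rw [div_lt_iff₀ (by positivity)]; linarith
    · rw [Real.exp_le_exp, ← hv_def]
      refine le_of_eq ?_
      have h2 : 1 - 3 * d / (6 * v + d) / 3 = 6 * v / (6 * v + d) := by field_simp; ring
      rw [h2]
      field_simp
      ring

/-! ### Sums of independent Bernoulli variables -/

theorem mgf_bernoulli {Ω : Type*} [MeasurableSpace Ω] {P : Measure Ω} {p : unitInterval} {Y : Ω → ℝ}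
    (hY : HasLaw Y (bernoulliMeasure (1 : ℝ) 0 p) P) (t : ℝ) :
    mgf Y P t = 1 - p + p * Real.exp t := by
  rw [mgf]
  have h := hY.integral_comp (f := fun x => Real.exp (t * x))
    (by fun_prop : Continuous fun x : ℝ => Real.exp (t * x)).aestronglyMeasurable
  rw [integral_bernoulliMeasure] at h
  refine Eq.trans h ?_
  simp
  ring

theorem variance_bernoulli {Ω : Type*} [MeasurableSpace Ω] {P : Measure Ω} {p : unitInterval}
    {Y : Ω → ℝ} (hY : HasLaw Y (bernoulliMeasure (1 : ℝ) 0 p) P) :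
    Var[Y; P] = p * (1 - p) := by
  rw [hY.variance_eq, variance_eq_integral aemeasurable_id, integral_bernoulliMeasure,
    integral_bernoulliMeasure]
  simp
  ring

section Sums

variable {Ω ι : Type*} [MeasurableSpace Ω] {P : Measure Ω} [IsProbabilityMeasure P]
  {p : unitInterval} {X : ι → Ω → ℝ}

/-- The distribution function of a sum of independent Bernoulli variables. Equality holds, but the
lower bound suffices and does not need the sum to be an integer almost surely. -/
theorem binomialCDF_le_measureReal_sum_le (hX : ∀ i, Measurable (X i))
    (hlaw : ∀ i, HasLaw (X i) (bernoulliMeasure (1 : ℝ) 0 p) P) (hind : iIndepFun X P)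
    (S : Finset ι) (k : ℕ) :
    binomialCDF S.card k p ≤ P.real {ω | ∑ i ∈ S, X i ω ≤ k} := by
  classical
  induction S using Finset.induction_on generalizing k with
  | empty => simp [binomialCDF_eq_one]
  | insert i S hi ih =>
    have hSm : Measurable (fun ω => ∑ i ∈ S, X i ω) := Finset.measurable_sum S fun i _ => hX i
    have hI : IndepFun (fun ω => ∑ i ∈ S, X i ω) (X i) P := by
      have := hind.indepFun_finsetSum_of_notMem hX hi
      convert this using 1
      ext ω; simp
    have hmul : ∀ (x : ℝ) (c : ℝ), P.real {ω | ∑ i ∈ S, X i ω ≤ x ∧ X i ω = c} =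
        P.real {ω | ∑ i ∈ S, X i ω ≤ x} * P.real {ω | X i ω = c} := by
      intro x c
      have := hI.measure_inter_preimage_eq_mul (Set.Iic x) {c} measurableSet_Iic
        (measurableSet_singleton c)
      rw [measureReal_def, measureReal_def, measureReal_def, ← ENNReal.toReal_mul]
      exact congrArg ENNReal.toReal this
    have hone : P.real {ω | X i ω = 1} = p := by
      rw [(hlaw i).measureReal_eq (p := fun x => x = 1) (measurableSet_singleton (1 : ℝ))]
      exact bernoulliMeasure_real_apply_of_mem_of_notMem p (measurableSet_singleton (1 : ℝ))
        (by simp) (by simp)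
    have hzero : P.real {ω | X i ω = 0} = 1 - p := by
      rw [(hlaw i).measureReal_eq (p := fun x => x = 0) (measurableSet_singleton (0 : ℝ))]
      exact bernoulliMeasure_real_apply_of_notMem_of_mem p (measurableSet_singleton (0 : ℝ))
        (by simp) (by simp)
    rw [Finset.card_insert_of_notMem hi]
    simp only [Finset.sum_insert hi]
    have hp0 : (0 : ℝ) ≤ p := p.2.1
    have hp1 : (0 : ℝ) ≤ 1 - p := by linarith [p.2.2]
    cases k with
    | zero =>
      rw [binomialCDF_succ_zero]
      calc (1 - (p : ℝ)) * binomialCDF S.card 0 p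
          ≤ (1 - p) * P.real {ω | ∑ i ∈ S, X i ω ≤ (0 : ℕ)} := by gcongr; exact ih 0
        _ = P.real {ω | ∑ i ∈ S, X i ω ≤ (0 : ℕ) ∧ X i ω = 0} := by rw [hmul, hzero, mul_comm]
        _ ≤ _ := by
          refine measureReal_mono fun ω hω => ?_
          simp only [Set.mem_ofPred_eq] at hω ⊢
          linarith [hω.1, hω.2]
    | succ k =>
      rw [binomialCDF_succ_succ]
      have hdisj : Disjoint {ω | ∑ i ∈ S, X i ω ≤ (k : ℕ) ∧ X i ω = 1}
          {ω | ∑ i ∈ S, X i ω ≤ (k + 1 : ℕ) ∧ X i ω = 0} := by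
        rw [Set.disjoint_left]
        intro ω h1 h2
        have := h1.2.symm.trans h2.2
        norm_num at this
      have hms : MeasurableSet {ω | ∑ i ∈ S, X i ω ≤ (k + 1 : ℕ) ∧ X i ω = 0} :=
        (measurableSet_le hSm measurable_const).inter (hX i (measurableSet_singleton 0))
      calc (p : ℝ) * binomialCDF S.card k p + (1 - p) * binomialCDF S.card (k + 1) p
          ≤ p * P.real {ω | ∑ i ∈ S, X i ω ≤ (k : ℕ)}
            + (1 - p) * P.real {ω | ∑ i ∈ S, X i ω ≤ (k + 1 : ℕ)} := by
            gcongr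
            · exact ih k
            · exact ih (k + 1)
        _ = P.real ({ω | ∑ i ∈ S, X i ω ≤ (k : ℕ) ∧ X i ω = 1} ∪
              {ω | ∑ i ∈ S, X i ω ≤ (k + 1 : ℕ) ∧ X i ω = 0}) := by
            rw [measureReal_union hdisj hms, hmul, hmul, hzero, hone]; ring
        _ ≤ _ := by
          refine measureReal_mono fun ω hω => ?_
          simp only [Set.mem_union, Set.mem_ofPred_eq] at hω ⊢
          push_cast at hω ⊢
          rcases hω with hω | hω <;> linarith [hω.1, hω.2]

/-- A sum of `m` independent Bernoulli variables with mean `p` exceeds `(m + 2) * p` with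
probability at most `3 / 4`. -/
theorem measureReal_lt_sum_le (hX : ∀ i, Measurable (X i))
    (hlaw : ∀ i, HasLaw (X i) (bernoulliMeasure (1 : ℝ) 0 p) P) (hind : iIndepFun X P)
    (S : Finset ι) :
    P.real {ω | ((S.card : ℝ) + 2) * p < ∑ i ∈ S, X i ω} ≤ 3 / 4 := by
  have hSm : Measurable (fun ω => ∑ i ∈ S, X i ω) := Finset.measurable_sum S fun i _ => hX i
  have hp0 : (0 : ℝ) ≤ p := p.2.1
  have h1 := (one_fourth_le_binomialCDF S.card hp0 p.2.2).trans
    (binomialCDF_le_measureReal_sum_le hX hlaw hind S _)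
  have h2 : P.real {ω | ∑ i ∈ S, X i ω ≤ (⌊((S.card : ℝ) + 2) * p⌋₊ : ℝ)} ≤
      P.real {ω | ((S.card : ℝ) + 2) * p < ∑ i ∈ S, X i ω}ᶜ := by
    refine measureReal_mono fun ω hω => ?_
    simp only [Set.mem_compl_iff, Set.mem_ofPred_eq, not_lt] at hω ⊢
    exact hω.trans (Nat.floor_le (by positivity))
  rw [probReal_compl_eq_one_sub (measurableSet_lt measurable_const hSm)] at h2
  linarith

/-- Bernstein's inequality for the lower tail of a sum of independent Bernoulli variables with mean
`p`, at a deviation of `d / 2` per variable. -/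
theorem measureReal_sum_le_le_exp (hX : ∀ i, Measurable (X i))
    (hlaw : ∀ i, HasLaw (X i) (bernoulliMeasure (1 : ℝ) 0 p) P) (hind : iIndepFun X P)
    {d : ℝ} (hd : 0 < d) (hdp : d ≤ p) (S : Finset ι) :
    P.real {ω | ∑ i ∈ S, X i ω ≤ S.card * (p - d / 2)} ≤
      Real.exp (-(S.card * (d ^ 2 / (8 * (p * (1 - p)) + 4 / 3 * d)))) := by
  obtain ⟨s, hs, hle⟩ := exists_bernoulli_mgf_neg_le hd hdp p.2.2
  have hmgf := hind.mgf_sum hX S (t := -s)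
  simp only [mgf_bernoulli (hlaw _), Finset.prod_const] at hmgf
  have hp : (0 : ℝ) < p := hd.trans_le hdp
  have hpos : 0 < 1 - (p : ℝ) + p * Real.exp (-s) := by
    have := mul_pos hp (Real.exp_pos (-s))
    linarith [p.2.2]
  have hint : Integrable (fun ω => Real.exp (-s * (∑ i ∈ S, X i) ω)) P := by
    refine mgf_pos_iff.1 ?_
    rw [hmgf]
    positivity
  have h := measure_le_le_exp_mul_mgf (μ := P) (S.card * ((p : ℝ) - d / 2))
    (neg_nonpos.2 hs) hint
  rw [hmgf] at h
  simp only [Finset.sum_apply] at h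
  refine h.trans ?_
  calc Real.exp (- -s * (S.card * ((p : ℝ) - d / 2))) * (1 - (p : ℝ) + p * Real.exp (-s)) ^ S.card
      ≤ Real.exp (- -s * (S.card * ((p : ℝ) - d / 2))) *
        Real.exp (-(s * (p - d / 2)) - d ^ 2 / (8 * (p * (1 - p)) + 4 / 3 * d)) ^ S.card := by
        gcongr
    _ = _ := by
      rw [← Real.exp_nat_mul, ← Real.exp_add]
      congr 1
      ring

/-- Sums over disjoint index sets are independent: the probability that all of the first `r` exceed
given thresholds is a product. -/
theorem measureReal_forall_lt_sum (hX : ∀ i, Measurable (X i)) (hind : iIndepFun X P)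
    {S : ℕ → Finset ι} {r : ℕ}
    (hS : ∀ i < r, ∀ j < r, i ≠ j → Disjoint (S i) (S j)) (c : ℕ → ℝ) :
    P.real {ω | ∀ j < r, c j < ∑ i ∈ S j, X i ω} =
      ∏ j ∈ Finset.range r, P.real {ω | c j < ∑ i ∈ S j, X i ω} := by
  classical
  induction r with
  | zero => simp
  | succ r ih =>
    rw [Finset.prod_range_succ, ← ih fun i hi j hj => hS i (by omega) j (by omega)]
    set m : ι → MeasurableSpace Ω := fun i => MeasurableSpace.comap (X i) inferInstance with hm
    set T : Set ι := {i | ∃ j < r, i ∈ S j} with hT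
    have hdisj : Disjoint T (S r : Set ι) := by
      rw [Set.disjoint_left]
      rintro i ⟨j, hj, hij⟩ hir
      exact Finset.disjoint_left.1 (hS j (by omega) r (by omega) hj.ne) hij hir
    have hI := indep_iSup_of_disjoint (fun i => (hX i).comap_le) hind.iIndep hdisj
    have hmeas : ∀ (U : Set ι) (j : ℕ), (S j : Set ι) ⊆ U →
        MeasurableSet[⨆ i ∈ U, m i] {ω | c j < ∑ i ∈ S j, X i ω} := by
      intro U j hU
      have hsum : Measurable[⨆ i ∈ U, m i] (fun ω => ∑ i ∈ S j, X i ω) := by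
        refine Finset.measurable_sum (S j) fun i hi => ?_
        exact (comap_measurable (X i)).mono (le_iSup₂_of_le i (hU hi) le_rfl) le_rfl
      exact hsum measurableSet_Ioi
    have h := (Indep_iff _ _ P).1 hI {ω | ∀ j < r, c j < ∑ i ∈ S j, X i ω}
      {ω | c r < ∑ i ∈ S r, X i ω} ?_ (hmeas _ r subset_rfl)
    · rw [measureReal_def, measureReal_def, measureReal_def, ← ENNReal.toReal_mul, ← h]
      congr 2
      ext ω
      simp only [Set.mem_ofPred_eq, Set.mem_inter_iff, Nat.lt_succ_iff_lt_or_eq]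
      constructor
      · exact fun H => ⟨fun j hj => H j (Or.inl hj), H r (Or.inr rfl)⟩
      · rintro ⟨H1, H2⟩ j (hj | rfl)
        exacts [H1 j hj, H2]
    · have : {ω | ∀ j < r, c j < ∑ i ∈ S j, X i ω} =
          ⋂ j ∈ Finset.range r, {ω | c j < ∑ i ∈ S j, X i ω} := by
        ext ω; simp
      rw [this]
      refine Finset.measurableSet_biInter _ fun j hj => hmeas T j fun i hi => ?_
      exact ⟨j, Finset.mem_range.1 hj, hi⟩

end Sums

/-! ### Batches -/

theorem mem_batch {l n j n' : ℕ} :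
    n' ∈ batch l n j ↔ (1 ≤ n' ∧ n' ≤ n) ∧ ∃ i : ℕ, n' = j + i * l := by
  simp [batch]

theorem disjoint_batch {l n i j : ℕ} (hi : i < l) (hj : j < l) (hij : i ≠ j) :
    Disjoint (batch l n (i + 1)) (batch l n (j + 1)) := by
  rw [Finset.disjoint_left]
  intro n' h1 h2
  obtain ⟨-, a, ha⟩ := mem_batch.1 h1
  obtain ⟨-, b, hb⟩ := mem_batch.1 h2
  have h : (i + a * l) % l = (j + b * l) % l := by
    congr 1
    omega
  rw [Nat.add_mul_mod_self_right, Nat.add_mul_mod_self_right, Nat.mod_eq_of_lt hi,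
    Nat.mod_eq_of_lt hj] at h
  exact hij h

theorem div_le_card_batch {l n j : ℕ} (hj : j < l) : n / l ≤ (batch l n (j + 1)).card := by
  have h : ((Finset.range (n / l)).image fun i => j + 1 + i * l) ⊆ batch l n (j + 1) := by
    intro n' hn'
    obtain ⟨i, hi, rfl⟩ := Finset.mem_image.1 hn'
    rw [Finset.mem_range] at hi
    have h1 : (i + 1) * l ≤ n := (Nat.mul_le_mul_right l hi).trans (Nat.div_mul_le_self n l)
    rw [add_mul, one_mul] at h1
    exact mem_batch.2 ⟨⟨by omega, by omega⟩, i, rfl⟩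
  refine le_trans ?_ (Finset.card_le_card h)
  rw [Finset.card_image_of_injective, Finset.card_range]
  intro a b hab
  have : a * l = b * l := by simpa using hab
  exact Nat.eq_of_mul_eq_mul_right (by omega) this

/-- A batch, with its indices lowered by one so that they start at `0`. -/
noncomputable def shiftedBatch (l n j : ℕ) : Finset ℕ :=
  (batch l n j).image (· - 1)

theorem injOn_pred_batch (l n j : ℕ) : Set.InjOn (· - 1) (batch l n j : Set ℕ) := by
  intro a ha b hb hab
  have h1 := (mem_batch.1 ha).1.1
  have h2 := (mem_batch.1 hb).1.1
  simp only at hab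
  omega

theorem card_shiftedBatch (l n j : ℕ) : (shiftedBatch l n j).card = (batch l n j).card :=
  Finset.card_image_of_injOn (injOn_pred_batch l n j)

theorem sum_shiftedBatch (l n j : ℕ) (x : ℕ → ℝ) :
    ∑ i ∈ shiftedBatch l n j, x (i + 1) = ∑ n' ∈ batch l n j, x n' := by
  rw [shiftedBatch, Finset.sum_image (injOn_pred_batch l n j)]
  refine Finset.sum_congr rfl fun n' hn' => ?_
  rw [Nat.sub_add_cancel (mem_batch.1 hn').1.1]

theorem disjoint_shiftedBatch {l n i j : ℕ} (hi : i < l) (hj : j < l) (hij : i ≠ j) :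
    Disjoint (shiftedBatch l n (i + 1)) (shiftedBatch l n (j + 1)) := by
  rw [Finset.disjoint_left]
  intro n' h1 h2
  obtain ⟨a, ha, ha'⟩ := Finset.mem_image.1 h1
  obtain ⟨b, hb, hb'⟩ := Finset.mem_image.1 h2
  have h3 := (mem_batch.1 ha).1.1
  have h4 := (mem_batch.1 hb).1.1
  obtain rfl : a = b := by omega
  exact Finset.disjoint_left.1 (disjoint_batch hi hj hij) ha hb

theorem lt_batchEstimate_iff {l n j : ℕ} {x : ℕ → ℝ} {c : ℝ} :
    c < batchEstimate l n j x ↔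
      (((shiftedBatch l n j).card : ℝ) + 2) * c < ∑ i ∈ shiftedBatch l n j, x (i + 1) := by
  rw [batchEstimate, card_shiftedBatch, sum_shiftedBatch, lt_div_iff₀ (by positivity), mul_comm]

theorem exists_batchEstimate_le {l n : ℕ} (hl : 1 ≤ l) {x : ℕ → ℝ} {c : ℝ}
    (h : estimate l n x ≤ c) : ∃ j < l, batchEstimate l n (j + 1) x ≤ c := by
  have : Nonempty (Fin l) := ⟨⟨0, hl⟩⟩
  obtain ⟨j, hj⟩ := exists_eq_ciInf_of_finite (f := fun j : Fin l => batchEstimate l n (j + 1) x)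
  exact ⟨j, j.2, hj.trans_le h⟩

theorem lt_batchEstimate_of_lt_estimate {l n : ℕ} {x : ℕ → ℝ} {c : ℝ}
    (h : c < estimate l n x) : ∀ j < l, c < batchEstimate l n (j + 1) x := fun j hj =>
  h.trans_le (ciInf_le (Set.finite_range _).bddBelow (⟨j, hj⟩ : Fin l))

/-! ### Deviations of the batch estimates -/

section Bandit

variable {Ω : Type*} [MeasurableSpace Ω] {P : Measure Ω} [IsProbabilityMeasure P]
  {K : ℕ} {μ : Fin K → unitInterval} {ℓ : Fin K → ℕ → Ω → ℝ}

/-- With `l` batches, the estimate of an arm exceeds the mean of the arm with exponentially small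
probability in `l`. -/
theorem measureReal_forall_lt_batchEstimate_le (hb : IsBernoulliBandit P μ ℓ) (a : Fin K)
    (l n : ℕ) :
    P.real {ω | ∀ j < l, (μ a : ℝ) < batchEstimate l n (j + 1) (fun i => ℓ a i ω)} ≤
      (3 / 4) ^ l := by
  have hX : ∀ i, Measurable (ℓ a (i + 1)) := fun i => hb.measurable_loss a _ (by omega)
  simp only [lt_batchEstimate_iff]
  rw [measureReal_forall_lt_sum hX (hb.indep_loss a)
    (S := fun j => shiftedBatch l n (j + 1))
    (fun i hi j hj hij => disjoint_shiftedBatch hi hj hij)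
    (fun j => (((shiftedBatch l n (j + 1)).card : ℝ) + 2) * μ a)]
  refine (Finset.prod_le_prod (g := fun _ => (3 / 4 : ℝ)) (fun j _ => measureReal_nonneg)
    fun j _ => ?_).trans_eq (by rw [Finset.prod_const, Finset.card_range])
  exact measureReal_lt_sum_le hX (fun i => hb.law_loss a _ (by omega)) (hb.indep_loss a) _

/-- A large batch of an arm whose mean exceeds that of `b` by `d` rarely falls below the mean of
`b`. The condition `4 ≤ m * d` absorbs the bias due to the two extra terms in the denominator. -/
theorem measureReal_batchEstimate_le (hb : IsBernoulliBandit P μ ℓ) (a b : Fin K) {l n j m : ℕ}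
    (hj : j < l) (hm : m ≤ n / l) (hd : 0 < gap μ b a) (hmd : 4 ≤ m * gap μ b a) :
    P.real {ω | batchEstimate l n (j + 1) (fun i => ℓ a i ω) ≤ μ b} ≤
      Real.exp (-(m * (gap μ b a ^ 2 / (8 * (μ a * (1 - μ a)) + 4 / 3 * gap μ b a)))) := by
  have hX : ∀ i, Measurable (ℓ a (i + 1)) := fun i => hb.measurable_loss a _ (by omega)
  set d := gap μ b a with hd_def
  set S := shiftedBatch l n (j + 1) with hS
  have hb0 : (0 : ℝ) ≤ μ b := (μ b).2.1
  have hb1 : (μ b : ℝ) ≤ 1 := (μ b).2.2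
  have ha0 : (0 : ℝ) ≤ μ a := (μ a).2.1
  have ha1 : (0 : ℝ) ≤ 1 - μ a := by linarith [(μ a).2.2]
  have hda : (μ a : ℝ) = μ b + d := by rw [hd_def, gap]; ring
  have hmS : (m : ℝ) ≤ S.card := by
    rw [hS, card_shiftedBatch]
    exact_mod_cast hm.trans (div_le_card_batch hj)
  calc P.real {ω | batchEstimate l n (j + 1) (fun i => ℓ a i ω) ≤ μ b}
      ≤ P.real {ω | ∑ i ∈ S, ℓ a (i + 1) ω ≤ S.card * (μ a - d / 2)} := by
        refine measureReal_mono fun ω hω => ?_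
        rw [Set.mem_ofPred_eq, ← not_lt, lt_batchEstimate_iff, not_lt] at hω
        rw [Set.mem_ofPred_eq]
        refine hω.trans ?_
        rw [hda]
        nlinarith [mul_le_mul_of_nonneg_right hmS hd.le]
    _ ≤ Real.exp (-(S.card * (d ^ 2 / (8 * (μ a * (1 - μ a)) + 4 / 3 * d)))) :=
        measureReal_sum_le_le_exp hX (fun i => hb.law_loss a _ (by omega)) (hb.indep_loss a) hd
          (by linarith) S
    _ ≤ _ := by gcongr

end Bandit

/-! ### The number of plays of an arm, for a fixed loss table -/

theorem pullCount_le {K : ℕ} (A : ℕ → Fin K) (b : Fin K) (t : ℕ) : pullCount A b t ≤ t := by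
  refine (Finset.card_filter_le _ _).trans ?_
  simp

theorem pullCount_lt_pullCount {K : ℕ} {A : ℕ → Fin K} {a : Fin K} {s s' : ℕ} (hs : 1 ≤ s)
    (hss' : s < s') (ha : A s = a) : pullCount A a (s - 1) < pullCount A a (s' - 1) := by
  refine Finset.card_lt_card ((Finset.ssubset_iff_of_subset fun u hu => ?_).2 ⟨s, ?_, ?_⟩)
  · simp only [Finset.mem_filter, Finset.mem_Icc] at hu ⊢
    exact ⟨⟨hu.1.1, by omega⟩, hu.2⟩
  · simp only [Finset.mem_filter, Finset.mem_Icc]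
    exact ⟨⟨hs, by omega⟩, ha⟩
  · simp only [Finset.mem_filter, Finset.mem_Icc]
    omega

theorem injOn_pullCount_pred {K : ℕ} {A : ℕ → Fin K} {a : Fin K} {T : Finset ℕ}
    (hT : ∀ s ∈ T, 1 ≤ s ∧ A s = a) : Set.InjOn (fun s => pullCount A a (s - 1)) (T : Set ℕ) := by
  intro s hs s' hs' h
  simp only at h
  rcases lt_trichotomy s s' with hlt | heq | hgt
  · exact absurd h (pullCount_lt_pullCount (hT s hs).1 hlt (hT s hs).2).ne
  · exact heq
  · exact absurd h (pullCount_lt_pullCount (hT s' hs').1 hgt (hT s' hs').2).ne'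

theorem ite_exists_le_sum {ι : Type*} (S : Finset ι) (p : ι → Prop) [DecidablePred p]
    [Decidable (∃ i ∈ S, p i)] :
    (if ∃ i ∈ S, p i then (1 : ℝ) else 0) ≤ ∑ i ∈ S, if p i then 1 else 0 := by
  split_ifs with h
  · obtain ⟨i, hi, hpi⟩ := h
    calc (1 : ℝ) = if p i then 1 else 0 := by rw [if_pos hpi]
      _ ≤ _ := Finset.single_le_sum (f := fun i => if p i then (1 : ℝ) else 0)
        (fun i _ => by positivity) hi
  · exact Finset.sum_nonneg fun i _ => by positivity

open Classical in
/-- The plays of an arm `a` up to time `t` fall into three classes: those with fewer than `N`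
earlier plays of `a`; those where some batch of `a` is at most `c`; and those where all batches
of `b` exceed `c`, in which case the number of plays of `b` is bounded by the time. A play of
the second class is determined by the number of earlier plays, so that the sum runs over this number
and over all possible numbers `r` of batches, but not over the time. -/
theorem pullCount_le_sum {K : ℕ} {l : ℕ → ℕ} {x : Fin K → ℕ → ℝ} {A : ℕ → Fin K}
    (hA : IsExecution l x A) (a b : Fin K) (c : ℝ) {t R : ℕ}
    (hl : ∀ s, 1 ≤ s → s ≤ t → 1 ≤ l s ∧ l s ≤ R) (N : ℕ) :
    (pullCount A a t : ℝ) ≤ N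
      + (∑ n ∈ Finset.Ico N t, ∑ r ∈ Finset.Icc 1 R, ∑ j ∈ Finset.range r,
          if batchEstimate r n (j + 1) (x a) ≤ c then 1 else 0)
      + ∑ s ∈ Finset.Icc 1 t, ∑ n ∈ Finset.range s,
          if ∀ j < l s, c < batchEstimate (l s) n (j + 1) (x b) then 1 else 0 := by
  set F := (Finset.Icc 1 t).filter fun s => A s = a with hF
  have hFmem : ∀ s ∈ F, (1 ≤ s ∧ s ≤ t) ∧ A s = a := by
    intro s hs
    simpa [hF] using hs
  set low : ℕ → Prop := fun n =>
    ∃ r ∈ Finset.Icc 1 R, ∃ j ∈ Finset.range r, batchEstimate r n (j + 1) (x a) ≤ c with hlow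
  set high : ℕ → Prop := fun s =>
    ∃ n ∈ Finset.range s, ∀ j < l s, c < batchEstimate (l s) n (j + 1) (x b) with hhigh
  set F₁ := F.filter fun s => pullCount A a (s - 1) < N with hF₁
  set F₂ := F.filter fun s => N ≤ pullCount A a (s - 1) ∧ low (pullCount A a (s - 1)) with hF₂
  set F₃ := (Finset.Icc 1 t).filter high with hF₃
  have hsub : F ⊆ F₁ ∪ F₂ ∪ F₃ := by
    intro s hs
    obtain ⟨⟨hs1, hst⟩, hsa⟩ := hFmem s hs
    simp only [Finset.mem_union, hF₁, hF₂, hF₃, Finset.mem_filter, Finset.mem_Icc]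
    rcases lt_or_ge (pullCount A a (s - 1)) N with h | h
    · exact Or.inl (Or.inl ⟨hs, h⟩)
    rcases lt_or_ge c (estimate (l s) (pullCount A b (s - 1)) (x b)) with h' | h'
    · refine Or.inr ⟨⟨hs1, hst⟩, pullCount A b (s - 1), ?_, lt_batchEstimate_of_lt_estimate h'⟩
      have := pullCount_le A b (s - 1)
      rw [Finset.mem_range]
      omega
    · have h2 := (hA s hs1 b).trans h'
      rw [hsa] at h2
      obtain ⟨j, hj, hle⟩ := exists_batchEstimate_le (hl s hs1 hst).1 h2
      exact Or.inl (Or.inr ⟨hs, h, l s, Finset.mem_Icc.2 (hl s hs1 hst), j,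
        Finset.mem_range.2 hj, hle⟩)
  have h₁ : F₁.card ≤ N := by
    rw [← Finset.card_range N]
    refine Finset.card_le_card_of_injOn (fun s => pullCount A a (s - 1)) (fun s hs => ?_)
      (injOn_pullCount_pred fun s hs => ?_)
    · exact Finset.mem_coe.2 (Finset.mem_range.2 (Finset.mem_filter.1 hs).2)
    · have := hFmem s (Finset.mem_filter.1 hs).1
      exact ⟨this.1.1, this.2⟩
  have h₂ : F₂.card ≤ ((Finset.Ico N t).filter low).card := by
    refine Finset.card_le_card_of_injOn (fun s => pullCount A a (s - 1)) (fun s hs => ?_)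
      (injOn_pullCount_pred fun s hs => ?_)
    · have h := Finset.mem_filter.1 (Finset.mem_coe.1 hs)
      have h3 := hFmem s h.1
      have := pullCount_le A a (s - 1)
      exact Finset.mem_coe.2
        (Finset.mem_filter.2 ⟨Finset.mem_Ico.2 ⟨h.2.1, this.trans_lt (by omega)⟩, h.2.2⟩)
    · have := hFmem s (Finset.mem_filter.1 hs).1
      exact ⟨this.1.1, this.2⟩
  have hcard : (F.card : ℝ) ≤ N + ((Finset.Ico N t).filter low).card + F₃.card := by
    have h3 := Finset.card_le_card hsub
    have h4 := Finset.card_union_le (F₁ ∪ F₂) F₃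
    have h5 := Finset.card_union_le F₁ F₂
    exact_mod_cast (by omega : F.card ≤ N + ((Finset.Ico N t).filter low).card + F₃.card)
  refine hcard.trans (add_le_add (add_le_add le_rfl ?_) ?_)
  · rw [Finset.card_filter]
    push_cast
    refine Finset.sum_le_sum fun n _ => ?_
    refine (ite_exists_le_sum _ _).trans (Finset.sum_le_sum fun r _ => ite_exists_le_sum _ _)
  · rw [hF₃, Finset.card_filter]
    push_cast
    exact Finset.sum_le_sum fun s _ => ite_exists_le_sum _ _

theorem sum_pullCount {K : ℕ} (A : ℕ → Fin K) (t : ℕ) : ∑ a, pullCount A a t = t := by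
  simp only [pullCount]
  rw [← Finset.card_eq_sum_card_fiberwise (fun _ _ => Finset.mem_coe.2 (Finset.mem_univ _))]
  simp

theorem regret_eq_sum {K : ℕ} (μ : Fin K → unitInterval) (b : Fin K) (A : ℕ → Fin K) (t : ℕ) :
    regret μ b A t = ∑ a, gap μ b a * pullCount A a t := by
  rw [regret, ← Finset.sum_fiberwise (Finset.Icc 1 t) A]
  refine Finset.sum_congr rfl fun a _ => ?_
  rw [Finset.sum_congr rfl (g := fun _ => gap μ b a)
    (fun s hs => by rw [(Finset.mem_filter.1 hs).2, gap]), Finset.sum_const, pullCount,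
    nsmul_eq_mul, mul_comm]

/-! ### The expected number of plays -/

theorem measurable_batchEstimate {Ω : Type*} [MeasurableSpace Ω] {P : Measure Ω} {K : ℕ}
    {μ : Fin K → unitInterval} {ℓ : Fin K → ℕ → Ω → ℝ} (hb : IsBernoulliBandit P μ ℓ)
    (a : Fin K) (l n j : ℕ) :
    Measurable fun ω => batchEstimate l n j (fun i => ℓ a i ω) := by
  refine Measurable.div_const ?_ _
  exact Finset.measurable_sum _ fun i hi => hb.measurable_loss a i (mem_batch.1 hi).1.1

theorem measurable_pullCount {Ω : Type*} [MeasurableSpace Ω] {K : ℕ} {A : ℕ → Ω → Fin K}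
    (hA : ∀ t, 1 ≤ t → Measurable (A t)) (a : Fin K) (t : ℕ) :
    Measurable fun ω => (pullCount (fun s => A s ω) a t : ℝ) := by
  simp only [pullCount, Finset.card_filter]
  push_cast
  refine Finset.measurable_sum _ fun s hs => ?_
  exact Measurable.ite (hA s (Finset.mem_Icc.1 hs).1 (measurableSet_singleton a))
    measurable_const measurable_const

theorem integral_ite_eq {Ω : Type*} [MeasurableSpace Ω] {P : Measure Ω} {p : Ω → Prop}
    [DecidablePred p] (hp : MeasurableSet {ω | p ω}) :
    ∫ ω, (if p ω then (1 : ℝ) else 0) ∂P = P.real {ω | p ω} := by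
  rw [← integral_indicator_one hp]
  refine integral_congr_ae (Filter.Eventually.of_forall fun ω => ?_)
  simp [Set.indicator_apply]

section Expectation

variable {Ω : Type*} [MeasurableSpace Ω] {P : Measure Ω} [IsProbabilityMeasure P]
  {K : ℕ} {μ : Fin K → unitInterval} {ℓ : Fin K → ℕ → Ω → ℝ}

theorem integrable_pullCount {A : ℕ → Ω → Fin K} (hA : ∀ t, 1 ≤ t → Measurable (A t)) (a : Fin K)
    (t : ℕ) : Integrable (fun ω => (pullCount (fun s => A s ω) a t : ℝ)) P := by
  refine Integrable.of_bound (measurable_pullCount hA a t).aestronglyMeasurable (t : ℝ)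
    (Filter.Eventually.of_forall fun ω => ?_)
  rw [Real.norm_of_nonneg (by positivity)]
  exact_mod_cast pullCount_le _ a t

theorem integrable_ite {p : Ω → Prop} [DecidablePred p] (hp : MeasurableSet {ω | p ω}) :
    Integrable (fun ω => if p ω then (1 : ℝ) else 0) P := by
  refine Integrable.of_bound
    (Measurable.ite hp measurable_const measurable_const).aestronglyMeasurable 1
    (Filter.Eventually.of_forall fun ω => ?_)
  split_ifs <;> simp

theorem integral_pullCount_le (hb : IsBernoulliBandit P μ ℓ) {l : ℕ → ℕ} {A : ℕ → Ω → Fin K}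
    (hA : ∀ t, 1 ≤ t → Measurable (A t))
    (hrun : ∀ ω, IsExecution l (fun a n => ℓ a n ω) (fun t => A t ω))
    (a b : Fin K) (c : ℝ) {t R : ℕ} (hl : ∀ s, 1 ≤ s → s ≤ t → 1 ≤ l s ∧ l s ≤ R) (N : ℕ) :
    ∫ ω, (pullCount (fun s => A s ω) a t : ℝ) ∂P ≤ N
      + (∑ n ∈ Finset.Ico N t, ∑ r ∈ Finset.Icc 1 R, ∑ j ∈ Finset.range r,
          P.real {ω | batchEstimate r n (j + 1) (fun i => ℓ a i ω) ≤ c})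
      + ∑ s ∈ Finset.Icc 1 t, ∑ n ∈ Finset.range s,
          P.real {ω | ∀ j < l s, c < batchEstimate (l s) n (j + 1) (fun i => ℓ b i ω)} := by
  classical
  have m1 : ∀ n r j, MeasurableSet {ω | batchEstimate r n (j + 1) (fun i => ℓ a i ω) ≤ c} :=
    fun n r j => measurableSet_le (measurable_batchEstimate hb a r n _) measurable_const
  have m2 : ∀ s n, MeasurableSet
      {ω | ∀ j < l s, c < batchEstimate (l s) n (j + 1) (fun i => ℓ b i ω)} := by
    intro s n
    have : {ω | ∀ j < l s, c < batchEstimate (l s) n (j + 1) (fun i => ℓ b i ω)} =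
        ⋂ j ∈ Finset.range (l s),
          {ω | c < batchEstimate (l s) n (j + 1) (fun i => ℓ b i ω)} := by
      ext ω; simp
    rw [this]
    exact Finset.measurableSet_biInter _ fun j _ =>
      measurableSet_lt measurable_const (measurable_batchEstimate hb b _ n _)
  have i1 : Integrable (fun ω => ∑ n ∈ Finset.Ico N t, ∑ r ∈ Finset.Icc 1 R,
      ∑ j ∈ Finset.range r,
        if batchEstimate r n (j + 1) (fun i => ℓ a i ω) ≤ c then (1 : ℝ) else 0) P :=
    integrable_finsetSum _ fun n _ => integrable_finsetSum _ fun r _ =>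
      integrable_finsetSum _ fun j _ => integrable_ite (m1 n r j)
  have i2 : Integrable (fun ω => ∑ s ∈ Finset.Icc 1 t, ∑ n ∈ Finset.range s,
      if ∀ j < l s, c < batchEstimate (l s) n (j + 1) (fun i => ℓ b i ω) then (1 : ℝ) else 0) P :=
    integrable_finsetSum _ fun s _ => integrable_finsetSum _ fun n _ => integrable_ite (m2 s n)
  refine (integral_mono (integrable_pullCount hA a t)
    (((integrable_const (N : ℝ)).fun_add i1).fun_add i2)
    fun ω => pullCount_le_sum (hrun ω) a b c hl N).trans_eq ?_
  rw [integral_add ((integrable_const (N : ℝ)).fun_add i1) i2, integral_add (integrable_const _) i1]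
  congr 1
  · congr 1
    · simp
    · rw [integral_finsetSum _ fun n _ => integrable_finsetSum _ fun r _ =>
        integrable_finsetSum _ fun j _ => integrable_ite (m1 n r j)]
      refine Finset.sum_congr rfl fun n _ => ?_
      rw [integral_finsetSum _ fun r _ =>
        integrable_finsetSum _ fun j _ => integrable_ite (m1 n r j)]
      refine Finset.sum_congr rfl fun r _ => ?_
      rw [integral_finsetSum _ fun j _ => integrable_ite (m1 n r j)]
      exact Finset.sum_congr rfl fun j _ => integral_ite_eq (m1 n r j)
  · rw [integral_finsetSum _ fun s _ => integrable_finsetSum _ fun n _ => integrable_ite (m2 s n)]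
    refine Finset.sum_congr rfl fun s _ => ?_
    rw [integral_finsetSum _ fun n _ => integrable_ite (m2 s n)]
    exact Finset.sum_congr rfl fun n _ => integral_ite_eq (m2 s n)

/-- With at least `8 * log s - 1` batches, the failure probability `(3 / 4) ^ l` is of order
`s⁻²`, because `3 / 4 ≤ exp (-1 / 4)`. -/
theorem mul_three_fourths_pow_le {s l : ℕ} (hs : 1 ≤ s) (hl : 8 * Real.log s - 1 ≤ l) :
    (s : ℝ) * (3 / 4) ^ l ≤ 4 / 3 * (s : ℝ)⁻¹ := by
  have hs0 : (0 : ℝ) < s := by exact_mod_cast hs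
  have h34 : (3 / 4 : ℝ) ≤ Real.exp (-(1 / 4)) := by
    linarith [Real.add_one_le_exp (-(1 / 4) : ℝ)]
  have h43 : Real.exp (1 / 4) ≤ 4 / 3 := by
    rw [Real.exp_neg] at h34
    have := inv_anti₀ (by norm_num) h34
    rw [inv_inv] at this
    linarith
  have h1 : (3 / 4 : ℝ) ^ l ≤ 4 / 3 * ((s : ℝ)⁻¹ * (s : ℝ)⁻¹) := by
    calc (3 / 4 : ℝ) ^ l ≤ Real.exp (-(1 / 4)) ^ l := by gcongr
      _ = Real.exp (-(l / 4)) := by rw [← Real.exp_nat_mul]; congr 1; ring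
      _ ≤ Real.exp (1 / 4 + (-Real.log s + -Real.log s)) := by gcongr; linarith
      _ = Real.exp (1 / 4) * ((s : ℝ)⁻¹ * (s : ℝ)⁻¹) := by
        rw [Real.exp_add, Real.exp_add, Real.exp_neg, Real.exp_log hs0]
      _ ≤ _ := by gcongr
  calc (s : ℝ) * (3 / 4) ^ l ≤ s * (4 / 3 * ((s : ℝ)⁻¹ * (s : ℝ)⁻¹)) := by gcongr
    _ = _ := by field_simp

theorem sum_mul_three_fourths_pow_le {l : ℕ → ℕ} {t : ℕ}
    (hl : ∀ s, 1 ≤ s → s ≤ t → 8 * Real.log s - 1 ≤ l s) :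
    ∑ s ∈ Finset.Icc 1 t, (s : ℝ) * (3 / 4) ^ l s ≤ 4 / 3 * (1 + Real.log t) := by
  refine (Finset.sum_le_sum fun s hs => mul_three_fourths_pow_le (Finset.mem_Icc.1 hs).1
    (hl s (Finset.mem_Icc.1 hs).1 (Finset.mem_Icc.1 hs).2)).trans ?_
  rw [← Finset.mul_sum]
  have h := harmonic_le_one_add_log t
  rw [harmonic_eq_sum_Icc] at h
  push_cast at h
  gcongr

theorem four_le_log_seventy_two : 4 ≤ Real.log 72 := by
  rw [Real.le_log_iff_exp_le (by norm_num)]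
  have h : Real.exp 4 = Real.exp 1 ^ 4 := by rw [← Real.exp_nat_mul]; norm_num
  rw [h]
  calc Real.exp 1 ^ 4 ≤ 2.7182818286 ^ 4 := by gcongr; exact Real.exp_one_lt_d9.le
    _ ≤ 72 := by norm_num

/-- The expected contribution of a sub-optimal arm to the regret. A batch of `m` plays of the arm
is reliable once `m ≥ (8 * σ² / Δ² + 4 / (3 * Δ)) * log (72 * t)`; as there are at most
`8 * log t + 1` batches, all of them are this large after `N` plays. -/
theorem gap_mul_integral_pullCount_le (hb : IsBernoulliBandit P μ ℓ)
    {l : ℕ → ℕ} (hl : ∀ t, 1 ≤ t → 1 ≤ l t ∧ |(l t : ℝ) - 8 * Real.log t| ≤ 1)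
    {A : ℕ → Ω → Fin K} (hA : ∀ t, 1 ≤ t → Measurable (A t))
    (hrun : ∀ ω, IsExecution l (fun a n => ℓ a n ω) (fun t => A t ω))
    {a b : Fin K} (hd : 0 < gap μ b a) {t : ℕ} (ht : 1 ≤ t) :
    gap μ b a * ∫ ω, (pullCount (fun s => A s ω) a t : ℝ) ∂P ≤
      9 * (8 * (μ a * (1 - μ a)) / gap μ b a + 4 / 3) * Real.log (72 * t) ^ 2 := by
  set d := gap μ b a with hd_def
  set v : ℝ := μ a * (1 - μ a) with hv_def
  set L := Real.log (72 * t) with hL_def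
  have ht0 : (0 : ℝ) < t := by exact_mod_cast ht
  have hv : 0 ≤ v := mul_nonneg (μ a).2.1 (by linarith [(μ a).2.2])
  have hd1 : d ≤ 1 := by
    rw [hd_def, gap]
    linarith [(μ a).2.2, (μ b).2.1]
  have hlog0 : 0 ≤ Real.log t := Real.log_nonneg (by exact_mod_cast ht)
  have hLlog : Real.log t ≤ L - 4 := by
    rw [hL_def, Real.log_mul (by norm_num) ht0.ne']
    linarith [four_le_log_seventy_two]
  have hL4 : 4 ≤ L := by linarith
  set M : ℝ := (8 * v / d ^ 2 + 4 / (3 * d)) * L with hM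
  have hM0 : 0 ≤ M := by positivity
  set m := ⌈M⌉₊ with hm
  have hMm : M ≤ m := Nat.le_ceil M
  have hmM : (m : ℝ) ≤ M + 1 := (Nat.ceil_lt_add_one hM0).le
  set R := ⌊8 * Real.log t + 1⌋₊ with hR
  have hRle : (R : ℝ) ≤ 8 * Real.log t + 1 := Nat.floor_le (by positivity)
  have hlR : ∀ s, 1 ≤ s → s ≤ t → 1 ≤ l s ∧ l s ≤ R := by
    intro s hs hst
    refine ⟨(hl s hs).1, Nat.le_floor ?_⟩
    have h1 := (abs_le.1 (hl s hs).2).2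
    have h2 : Real.log s ≤ Real.log t :=
      Real.log_le_log (by exact_mod_cast hs) (by exact_mod_cast hst)
    linarith
  -- the bound for the probability that a batch of the arm `a` is misleading
  have hbatch : ∀ n ∈ Finset.Ico (R * m) t, ∀ r ∈ Finset.Icc 1 R, ∀ j ∈ Finset.range r,
      P.real {ω | batchEstimate r n (j + 1) (fun i => ℓ a i ω) ≤ μ b} ≤ (72 * t : ℝ)⁻¹ := by
    intro n hn r hr j hj
    rw [Finset.mem_Icc] at hr
    -- round robin gives every batch at least `⌊n / r⌋` elements
    have hmn : m ≤ n / r := by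
      rw [Nat.le_div_iff_mul_le (by omega), mul_comm]
      exact (Nat.mul_le_mul_right m hr.2).trans (Finset.mem_Ico.1 hn).1
    have hMd : M * d = (8 * v / d + 4 / 3) * L := by
      rw [hM]; field_simp
    have hmd : 4 ≤ m * d := by
      have h1 : M * d ≤ m * d := by gcongr
      have h2 : 0 ≤ 8 * v / d := by positivity
      nlinarith
    refine (measureReal_batchEstimate_le hb a b (Finset.mem_range.1 hj) hmn hd hmd).trans ?_
    rw [← Real.exp_log (show (0 : ℝ) < (72 * t : ℝ)⁻¹ by positivity), Real.log_inv]
    have h3 : M * (d ^ 2 / (8 * v + 4 / 3 * d)) = L := by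
      rw [hM]; field_simp
    have h4 : M * (d ^ 2 / (8 * v + 4 / 3 * d)) ≤ m * (d ^ 2 / (8 * v + 4 / 3 * d)) := by gcongr
    rw [Real.exp_le_exp, ← hd_def, ← hv_def, ← hL_def]
    linarith
  have hE := integral_pullCount_le hb hA hrun a b (μ b) hlR (R * m)
  have hfirst : ∑ n ∈ Finset.Ico (R * m) t, ∑ r ∈ Finset.Icc 1 R, ∑ j ∈ Finset.range r,
      P.real {ω | batchEstimate r n (j + 1) (fun i => ℓ a i ω) ≤ μ b} ≤ (R : ℝ) ^ 2 / 72 := by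
    calc _ ≤ ∑ n ∈ Finset.Ico (R * m) t, ∑ r ∈ Finset.Icc 1 R, ∑ j ∈ Finset.range r,
          (72 * t : ℝ)⁻¹ :=
          Finset.sum_le_sum fun n hn => Finset.sum_le_sum fun r hr =>
            Finset.sum_le_sum fun j hj => hbatch n hn r hr j hj
      _ ≤ ∑ n ∈ Finset.Ico (R * m) t, ∑ r ∈ Finset.Icc 1 R, (R : ℝ) * (72 * t : ℝ)⁻¹ := by
          refine Finset.sum_le_sum fun n _ => Finset.sum_le_sum fun r hr => ?_
          rw [Finset.sum_const, Finset.card_range, nsmul_eq_mul]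
          gcongr
          exact (Finset.mem_Icc.1 hr).2
      _ = ((t - R * m : ℕ) : ℝ) * (R * (R * (72 * t : ℝ)⁻¹)) := by
          rw [Finset.sum_const, Finset.sum_const, Nat.card_Ico, Nat.card_Icc, nsmul_eq_mul,
            nsmul_eq_mul, Nat.add_sub_cancel]
      _ ≤ (t : ℝ) * (R * (R * (72 * t : ℝ)⁻¹)) := by
          gcongr
          exact Nat.sub_le _ _
      _ = _ := by field_simp
  have hsecond : ∑ s ∈ Finset.Icc 1 t, ∑ n ∈ Finset.range s,
      P.real {ω | ∀ j < l s, (μ b : ℝ) < batchEstimate (l s) n (j + 1) (fun i => ℓ b i ω)} ≤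
      4 / 3 * (1 + Real.log t) := by
    refine le_trans (Finset.sum_le_sum fun s _ => ?_)
      (sum_mul_three_fourths_pow_le (l := l) (t := t) fun s hs _ => ?_)
    · refine (Finset.sum_le_sum fun n _ =>
        measureReal_forall_lt_batchEstimate_le hb b (l s) n).trans_eq ?_
      rw [Finset.sum_const, Finset.card_range, nsmul_eq_mul]
    · linarith [(abs_le.1 (hl s hs).2).1]
  set c := 8 * v / d + 4 / 3 with hc
  have hc43 : 4 / 3 ≤ c := by
    have : 0 ≤ 8 * v / d := by positivity
    linarith
  have hdm : d * m ≤ c * L + 1 := by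
    have h1 : d * M = c * L := by rw [hM, hc]; field_simp
    nlinarith [mul_le_mul_of_nonneg_left hmM hd.le]
  -- the constant `72` enters through `log 72 ≥ 4`, so that `R` falls short of `8 * L` by `31`
  have hR8 : (R : ℝ) ≤ 8 * L - 31 := by linarith
  push_cast at hE
  have hcL : 0 ≤ c * L := by positivity
  calc d * ∫ ω, (pullCount (fun s => A s ω) a t : ℝ) ∂P
      ≤ d * (R * m + R ^ 2 / 72 + 4 / 3 * (1 + Real.log t)) := by
        gcongr
        exact hE.trans (by gcongr)
    _ = R * (d * m) + d * (R ^ 2 / 72 + 4 / 3 * (1 + Real.log t)) := by ring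
    _ ≤ (8 * L - 31) * (c * L + 1) + 1 * ((8 * L - 31) ^ 2 / 72 + 4 / 3 * L) := by
        gcongr
        · linarith
        · linarith
    _ ≤ 9 * c * L ^ 2 := by nlinarith [mul_nonneg (sub_nonneg.2 hc43) (sq_nonneg L)]

theorem integral_regret {aStar : Fin K} (hA' : ∀ a, 0 ≤ gap μ aStar a) {A : ℕ → Ω → Fin K}
    (hA : ∀ t, 1 ≤ t → Measurable (A t)) (t : ℕ) :
    ∫ ω, regret μ aStar (fun s => A s ω) t ∂P =
      ∑ a ∈ subOptimal μ aStar, gap μ aStar a *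
        ∫ ω, (pullCount (fun s => A s ω) a t : ℝ) ∂P := by
  simp only [regret_eq_sum]
  rw [integral_finsetSum _ fun a _ => (integrable_pullCount hA a t).const_mul _]
  simp only [integral_const_mul]
  symm
  refine Finset.sum_subset (Finset.subset_univ _) fun a _ ha => ?_
  have h : ¬ 0 < gap μ aStar a := by simpa [subOptimal] using ha
  rw [le_antisymm (not_lt.1 h) (hA' a), zero_mul]

theorem sum_integral_pullCount {A : ℕ → Ω → Fin K} (hA : ∀ t, 1 ≤ t → Measurable (A t)) (t : ℕ) :
    ∑ a, ∫ ω, (pullCount (fun s => A s ω) a t : ℝ) ∂P = t := by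
  rw [← integral_finsetSum _ fun a _ => integrable_pullCount hA a t]
  have h : ∀ ω, ∑ a, (pullCount (fun s => A s ω) a t : ℝ) = t := fun ω => by
    exact_mod_cast sum_pullCount (fun s => A s ω) t
  simp [h]

end Expectation

/-! ### From gap-dependent to gap-free bounds -/

/-- Both `d * E` and `72 * w / d * L ^ 2` bound `d * E - κ * L ^ 2`, hence so does their geometric
mean, in which `d` cancels. -/
theorem mul_le_sqrt_add {d E w κ L : ℝ} (hd : 0 < d) (hE : 0 ≤ E) (hw : 0 ≤ w) (hκ : 0 ≤ κ)
    (hL : 0 ≤ L) (h : d * E ≤ (72 * w / d + κ) * L ^ 2) :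
    d * E ≤ 17 * L * (√w * √E) + κ * L ^ 2 := by
  have hdE : 0 ≤ d * E := by positivity
  have hκL : 0 ≤ κ * L ^ 2 := by positivity
  have hx : d * E - κ * L ^ 2 ≤ 17 * L * (√w * √E) := by
    rw [← Real.sqrt_mul hw]
    rcases le_total (d * E - κ * L ^ 2) 0 with h0 | h0
    · exact h0.trans (by positivity)
    refine abs_le_of_sq_le_sq' ?_ (by positivity) |>.2
    rw [mul_pow, Real.sq_sqrt (by positivity)]
    calc (d * E - κ * L ^ 2) ^ 2 = (d * E - κ * L ^ 2) * (d * E - κ * L ^ 2) := sq _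
      _ ≤ (d * E) * (72 * w / d * L ^ 2) := by
        gcongr
        · linarith
        · linarith
      _ = 72 * (L ^ 2 * (w * E)) := by field_simp
      _ ≤ 17 ^ 2 * (L ^ 2 * (w * E)) := by gcongr; norm_num
      _ = (17 * L) ^ 2 * (w * E) := by ring
  linarith

theorem sum_mul_le_sqrt {ι : Type*} (S : Finset ι) {d E w : ι → ℝ} {κ L T W k : ℝ}
    (hd : ∀ a ∈ S, 0 < d a) (hE : ∀ a, 0 ≤ E a) (hw : ∀ a, 0 ≤ w a) (hκ : 0 ≤ κ) (hL : 0 ≤ L)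
    (h : ∀ a ∈ S, d a * E a ≤ (72 * w a / d a + κ) * L ^ 2)
    (hT : ∑ a ∈ S, E a ≤ T) (hW : ∑ a ∈ S, w a ≤ W) (hk : S.card ≤ k) :
    ∑ a ∈ S, d a * E a ≤ 17 * √(T * W) * L + κ * k * L ^ 2 := by
  have hW0 : 0 ≤ W := (Finset.sum_nonneg fun a _ => hw a).trans hW
  calc ∑ a ∈ S, d a * E a ≤ ∑ a ∈ S, (17 * L * (√(w a) * √(E a)) + κ * L ^ 2) :=
        Finset.sum_le_sum fun a ha => mul_le_sqrt_add (hd a ha) (hE a) (hw a) hκ hL (h a ha)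
    _ = 17 * L * ∑ a ∈ S, √(w a) * √(E a) + S.card * (κ * L ^ 2) := by
        rw [Finset.sum_add_distrib, ← Finset.mul_sum, Finset.sum_const, nsmul_eq_mul]
    _ ≤ 17 * L * (√W * √T) + k * (κ * L ^ 2) := by
        gcongr
        refine (Real.sum_sqrt_mul_sqrt_le S hw hE).trans ?_
        gcongr
    _ = _ := by rw [mul_comm T W, Real.sqrt_mul hW0]; ring

end BatchEnsemble

theorem theorem2 {Ω : Type*} [MeasurableSpace Ω] (P : Measure Ω) [IsProbabilityMeasure P]
    {K : ℕ} (μ : Fin K → unitInterval) (ℓ : Fin K → ℕ → Ω → ℝ)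
    (hbandit : BatchEnsemble.IsBernoulliBandit P μ ℓ)
    (aStar : Fin K) (haStar : ∀ a, μ aStar ≤ μ a)
    -- the number of batches: `8 * log t`, rounded to a positive integer in any way
    (l : ℕ → ℕ) (hl : ∀ t, 1 ≤ t → 1 ≤ l t ∧ |(l t : ℝ) - 8 * Real.log t| ≤ 1)
    (A : ℕ → Ω → Fin K) (hA : ∀ t, 1 ≤ t → Measurable (A t))
    (hrun : ∀ ω, BatchEnsemble.IsExecution l (fun a n => ℓ a n ω) (fun t => A t ω)) :
    ∀ t : ℕ, 1 ≤ t →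
      (∫ ω, BatchEnsemble.regret μ aStar (fun s => A s ω) t ∂P
        ≤ ∑ a ∈ BatchEnsemble.subOptimal μ aStar,
            9 * (8 * Var[ℓ a 1; P] / BatchEnsemble.gap μ aStar a + 4 / 3)
              * Real.log (72 * t) ^ 2) ∧
      (∑ a ∈ BatchEnsemble.subOptimal μ aStar,
            9 * (8 * Var[ℓ a 1; P] / BatchEnsemble.gap μ aStar a + 4 / 3)
              * Real.log (72 * t) ^ 2
        ≤ ∑ a ∈ BatchEnsemble.subOptimal μ aStar,
            9 * (8 * (μ aStar : ℝ) / BatchEnsemble.gap μ aStar a + 28 / 3)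
              * Real.log (72 * t) ^ 2) ∧
      (∫ ω, BatchEnsemble.regret μ aStar (fun s => A s ω) t ∂P
        ≤ 17 * Real.sqrt (t * min ((μ aStar : ℝ) * K)
              (∑ a ∈ Finset.univ.erase aStar, Var[ℓ a 1; P])) * Real.log (72 * t)
          + 84 * K * Real.log (72 * t) ^ 2) := by
  intro t ht
  have hgap : ∀ a, 0 ≤ BatchEnsemble.gap μ aStar a := fun a => sub_nonneg.2 (haStar a)
  have hsub : ∀ a ∈ BatchEnsemble.subOptimal μ aStar, 0 < BatchEnsemble.gap μ aStar a :=
    fun a ha => by simpa [BatchEnsemble.subOptimal] using ha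
  have hvar : ∀ a, Var[ℓ a 1; P] = μ a * (1 - μ a) := fun a =>
    BatchEnsemble.variance_bernoulli (hbandit.law_loss a 1 le_rfl)
  have hv0 : ∀ a, (0 : ℝ) ≤ μ a * (1 - μ a) := fun a =>
    mul_nonneg (μ a).2.1 (by linarith [(μ a).2.2])
  have hv : ∀ a, (μ a * (1 - μ a) : ℝ) ≤ μ aStar + BatchEnsemble.gap μ aStar a := fun a => by
    rw [BatchEnsemble.gap]
    nlinarith [(μ a).2.1]
  simp only [hvar]
  have hL : 0 ≤ Real.log (72 * t) := by
    refine Real.log_nonneg ?_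
    have : (1 : ℝ) ≤ t := by exact_mod_cast ht
    linarith
  rw [BatchEnsemble.integral_regret hgap hA]
  set E : Fin K → ℝ := fun a => ∫ ω, (BatchEnsemble.pullCount (fun s => A s ω) a t : ℝ) ∂P with hE
  have hE0 : ∀ a, 0 ≤ E a := fun a => integral_nonneg fun ω => Nat.cast_nonneg _
  have harm : ∀ a ∈ BatchEnsemble.subOptimal μ aStar, BatchEnsemble.gap μ aStar a * E a ≤
      9 * (8 * (μ a * (1 - μ a)) / BatchEnsemble.gap μ aStar a + 4 / 3) * Real.log (72 * t) ^ 2 :=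
    fun a ha => BatchEnsemble.gap_mul_integral_pullCount_le hbandit hl hA hrun (hsub a ha) ht
  have hmean : ∀ a ∈ BatchEnsemble.subOptimal μ aStar,
      9 * (8 * (μ a * (1 - μ a)) / BatchEnsemble.gap μ aStar a + 4 / 3) * Real.log (72 * t) ^ 2 ≤
        9 * (8 * (μ aStar : ℝ) / BatchEnsemble.gap μ aStar a + 28 / 3)
          * Real.log (72 * t) ^ 2 := by
    intro a ha
    have hd := hsub a ha
    have h1 : 8 * (μ a * (1 - μ a) : ℝ) / BatchEnsemble.gap μ aStar a ≤
        8 * (μ aStar : ℝ) / BatchEnsemble.gap μ aStar a + 8 := by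
      rw [div_add' _ _ _ hd.ne']
      gcongr
      linarith [hv a]
    gcongr 9 * ?_ * _
    linarith
  have hT : ∑ a ∈ BatchEnsemble.subOptimal μ aStar, E a ≤ t := by
    rw [← BatchEnsemble.sum_integral_pullCount (P := P) hA t]
    exact Finset.sum_le_sum_of_subset_of_nonneg (Finset.subset_univ _) fun a _ _ => hE0 a
  have hcard : ((BatchEnsemble.subOptimal μ aStar).card : ℝ) ≤ K := by
    exact_mod_cast (Finset.card_le_univ _).trans_eq (Fintype.card_fin K)
  refine ⟨Finset.sum_le_sum harm, Finset.sum_le_sum hmean, ?_⟩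
  -- for the bound with the best mean, `σ² ≤ μ⋆ + Δ` moves `72` from the main term to the constant
  rcases min_choice ((μ aStar : ℝ) * K) (∑ a ∈ Finset.univ.erase aStar, (μ a * (1 - μ a) : ℝ))
    with h | h
  · rw [h]
    refine BatchEnsemble.sum_mul_le_sqrt _ (w := fun _ => (μ aStar : ℝ)) hsub hE0
      (fun _ => (μ aStar).2.1) (by norm_num) hL (fun a ha => ?_) hT ?_ hcard
    · refine ((harm a ha).trans (hmean a ha)).trans_eq ?_
      ring
    · rw [Finset.sum_const, nsmul_eq_mul, mul_comm]
      exact mul_le_mul_of_nonneg_left hcard (μ aStar).2.1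
  · rw [h]
    refine (BatchEnsemble.sum_mul_le_sqrt _ (w := fun a => (μ a * (1 - μ a) : ℝ)) (κ := 12)
      (W := ∑ a ∈ Finset.univ.erase aStar, (μ a * (1 - μ a) : ℝ)) hsub
      hE0 hv0 (by norm_num) hL (fun a ha => ?_) hT ?_ hcard).trans ?_
    · refine (harm a ha).trans_eq ?_
      ring
    · refine Finset.sum_le_sum_of_subset_of_nonneg (fun a ha => ?_) fun a _ _ => hv0 a
      refine Finset.mem_erase.2 ⟨?_, Finset.mem_univ a⟩
      rintro rfl
      have := hsub a ha
      simp [BatchEnsemble.gap] at this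
    · gcongr
      norm_num
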